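/- Let $V$ be a two-sided quaternionic Banach space and let $T$ be a closed (right or left) linear quaternionic operator on $V$ with domain $\mathcal D(T)$. Its S-resolvent set is $$\rho_S(T)=\{s\in\mathbb H:\ (T^2-2\operatorname{Re}(s)T+|s|^2 I)^{-1}\in\mathcal B(V)\},$$ where $T^2-2\operatorname{Re}(s)T+|s|^2I$ has domain $\mathcal D(T^2)$ and $\mathcal B(V)$ is the set of bounded everywhere defined linear operators on $V$ (with the same side of linearity as $T$). Its S-spectrum is $\sigma_S(T)=\mathbb H\setminus\rho_S(T)$, and its extended S-spectrum $\overline{\sigma_S}(T)\subset\mathbb H\cup\{\infty\}$ is $\sigma_S(T)$ if $T\in\mathcal B(V)$ and $\sigma_S(T)\cup\{\infty\}$ otherwise. Assume $\rho_S(T)\neq\emptyset$. An intrinsic rational function is a quotient $R=PQ^{-1}$ of polynomials with real coefficients, $Q\ne0$. Its poles are the zeros in $\mathbb H$ of the denominator of its reduced form. If $R$ has no poles on $\sigma_S(T)$, then $R(T):=P(T)Q(T)^{-1}$, where $PQ^{-1}$ is the reduced form of $R$; here a polynomial $P(T)=\sum_{\ell}a_\ell T^\ell$ has domain $\mathcal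 D(T^{\deg P})$, and sums and products of operators have their natural domains. $R$ is extended to $\mathbb H\cup\{\infty\}$ by $R(\infty)=\lim_{|q|\to\infty}R(q)$ and by the value $\infty$ at the poles. For operators, $A\subset B$ means that $B$ extends $A$. **Proposition 3.11.** Let $0\neq R=PQ^{-1}$ and $R_1=P_1Q_1^{-1}$ be intrinsic rational functions ($P,Q,P_1,Q_1$ real polynomials, $Q,Q_1\neq0$), and assume that $R$ has no poles on $\sigma_S(T)$; in (iii) and (iv) assume the same of $R_1$. Then: (i) $R(T)$ is a closed operator. (ii) $R(\overline{\sigma_S}(T))\subset\overline{\sigma_S}(R(T))$. (iii) $R(T)R_1(T)\subset(RR_1)(T)$, and equality holds if $(\deg P-\deg Q)(\deg P_1-\deg Q_1)\ge0$. (iv) $R(T)+R_1(T)\subset(R+R_1)(T)$, and equality holds if $\deg(PQ_1+P_1Q)=\max\{\deg(PQ_1),\deg(P_1Q)\}$. (In the degree conditions the zero polynomial may be given degree $0$.) -/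

import Mathlib

open scoped Quaternion Polynomial

/-! ### Partially defined operators

An operator on `V`, linear over the ring `A`, is a `LinearPMap`, i.e. a linear map on a submodule of
`V`, its domain. With `A = ℍᵐᵒᵖ` these are the right linear quaternionic operators, with `A = ℍ` the
left linear ones. Sums and real multiples are those of Mathlib: the domain of a sum is the
intersection of the domains, and `r • T` has the domain of `T`. -/

section Operators

variable {A V : Type*} [Ring A] [NormedAddCommGroup V] [Module A V]

/-- The composition `g f` of partially defined operators, with its natural domain
`{v ∈ D(f) | f v ∈ D(g)}`. -/
noncomputable def opComp (g f : V →ₗ.[A] V) : V →ₗ.[A] V :=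
  g.comp (f.domRestrict ((g.domain.comap f.toFun).map f.domain.subtype)) (by
    rintro ⟨x, hx, hx'⟩
    obtain ⟨y, hy, rfl⟩ := hx
    exact hy)

theorem mem_domain_opComp (g f : V →ₗ.[A] V) (v : V) :
    v ∈ (opComp g f).domain ↔ ∃ h : v ∈ f.domain, f ⟨v, h⟩ ∈ g.domain := by
  constructor
  · rintro ⟨hx, hx'⟩
    obtain ⟨y, hy, rfl⟩ := hx
    exact ⟨hx', hy⟩
  · rintro ⟨h, h'⟩
    exact ⟨⟨⟨v, h⟩, h', rfl⟩, h⟩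

theorem opComp_apply (g f : V →ₗ.[A] V) (v : V) (hv : v ∈ (opComp g f).domain)
    (h : v ∈ f.domain) (h' : f ⟨v, h⟩ ∈ g.domain) :
    opComp g f ⟨v, hv⟩ = g ⟨f ⟨v, h⟩, h'⟩ := rfl

variable [Algebra ℝ A] [NormedSpace ℝ V] [IsScalarTower ℝ A V]

/-- The powers of an operator: `T ^ 0 = I` and `T ^ (n + 1) = T (T ^ n)`, with the natural domains. -/
noncomputable def opPow (T : V →ₗ.[A] V) : ℕ → (V →ₗ.[A] V)
  | 0 => LinearMap.id.toPMap ⊤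
  | n + 1 => opComp T (opPow T n)

/-- The operator is closed: its graph is a closed set. -/
def IsClosedOp (T : V →ₗ.[A] V) : Prop :=
  IsClosed {x : V × V | x ∈ T.graph}

/-- The operator is bounded and everywhere defined, i.e. it belongs to `B(V)`. -/
def IsBoundedOp (T : V →ₗ.[A] V) : Prop :=
  ∃ B : V →L[A] V, T = (B : V →ₗ[A] V).toPMap ⊤

/-- `L⁻¹ ∈ B(V)`: the operator `L` has a two-sided inverse that is bounded and defined on all of
`V`. -/
def HasBoundedInverse (L : V →ₗ.[A] V) : Prop :=
  ∃ B : V →L[A] V, (∀ v : L.domain, B (L v) = v) ∧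
    ∀ w : V, ∃ h : B w ∈ L.domain, L ⟨B w, h⟩ = w

/-- The operator `T² - 2 Re(s) T + |s|² I` on the domain of `T²`. -/
noncomputable def sOp (T : V →ₗ.[A] V) (s : ℍ) : V →ₗ.[A] V :=
  opPow T 2 + (-(2 * s.re)) • T + (‖s‖ ^ 2) • opPow T 0

/-- The S-resolvent set of `T`. -/
def sResolventSet (T : V →ₗ.[A] V) : Set ℍ :=
  {s | HasBoundedInverse (sOp T s)}

/-- The S-spectrum of `T`. -/
def sSpectrum (T : V →ₗ.[A] V) : Set ℍ :=
  (sResolventSet T)ᶜ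

/-- The extended S-spectrum of `T`, in `ℍ ∪ {∞}`: the point `∞` is adjoined to the S-spectrum if `T`
is not a bounded everywhere defined operator. -/
def extSSpectrum (T : V →ₗ.[A] V) : Set (OnePoint ℍ) :=
  (fun s : ℍ => (s : OnePoint ℍ)) '' sSpectrum T ∪ {x | x = OnePoint.infty ∧ ¬ IsBoundedOp T}

/-- `P(T) = ∑ aₗ Tˡ` (sum over `l ≤ deg P`) for a polynomial with real coefficients; its domain is
that of `T ^ deg P`. -/
noncomputable def polyOp (P : ℝ[X]) (T : V →ₗ.[A] V) : V →ₗ.[A] V :=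
  ∑ l ∈ Finset.range (P.natDegree + 1), P.coeff l • opPow T l

/-- The rational functional calculus `R(T) = P(T) Q(T)⁻¹`, where `R = P Q⁻¹` in lowest terms. It is
used only if `R` has no poles on the S-spectrum of `T`, where `Q(T)` is injective. -/
noncomputable def ratOp (R : RatFunc ℝ) (T : V →ₗ.[A] V) : V →ₗ.[A] V :=
  opComp (polyOp R.num T) (polyOp R.denom T).inverse

end Operators

/-! ### Intrinsic rational functions

A quaternionic polynomial is intrinsic if it maps each complex plane `ℂᵢ` into itself; these are
exactly the polynomials with real coefficients. So the intrinsic rational functions are the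
quotients of real polynomials, considered as functions of a quaternionic variable. -/

/-- `p` maps each plane `ℂᵢ = {u + i v}`, where `i² = -1`, into itself. -/
def IsIntrinsicPoly (p : Polynomial ℍ) : Prop :=
  ∀ i : ℍ, i * i = -1 → ∀ u v : ℝ, ∃ a b : ℝ, p.eval ((u : ℍ) + v • i) = (a : ℍ) + b • i

theorem isIntrinsicPoly_iff (p : Polynomial ℍ) :
    IsIntrinsicPoly p ↔ ∃ p₀ : ℝ[X], p = p₀.map (algebraMap ℝ ℍ) := by
  constructor
  · intro h
    have comp : ∀ f : ℍ →ₗ[ℝ] ℝ, (∀ x : ℝ, f (p.eval (x : ℍ)) = 0) → ∀ n, f (p.coeff n) = 0 := by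
      intro f hf n
      let q : ℝ[X] := ∑ k ∈ Finset.range (p.natDegree + 1), Polynomial.monomial k (f (p.coeff k))
      have hq : q = 0 := by
        refine Polynomial.funext fun x => ?_
        have h1 : f (p.eval (x : ℍ)) = 0 := hf x
        rw [Polynomial.eval_eq_sum_range, map_sum] at h1
        rw [Polynomial.eval_zero, ← h1]
        simp only [q, Polynomial.eval_finsetSum, Polynomial.eval_monomial]
        refine Finset.sum_congr rfl fun k _ => ?_
        rw [← Quaternion.coe_pow, Quaternion.mul_coe_eq_smul, map_smul, smul_eq_mul, mul_comm]
      by_cases hn : n < p.natDegree + 1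
      · have h2 : q.coeff n = 0 := by rw [hq, Polynomial.coeff_zero]
        simpa [q, Polynomial.finsetSum_coeff, Polynomial.coeff_monomial, hn] using h2
      · rw [Polynomial.coeff_eq_zero_of_natDegree_lt (by omega), map_zero]
    have key : ∀ x : ℝ, (p.eval (x : ℍ)).imI = 0 ∧ (p.eval (x : ℍ)).imJ = 0 ∧
        (p.eval (x : ℍ)).imK = 0 := by
      intro x
      have hu : ∃ i j : ℍ, i * i = -1 ∧ j * j = -1 ∧ i.imJ = 0 ∧ i.imK = 0 ∧ j.imI = 0 := by
        let i : ℍ := ⟨0, 1, 0, 0⟩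
        let j : ℍ := ⟨0, 0, 1, 0⟩
        refine ⟨i, j, ?_, ?_, rfl, rfl, rfl⟩ <;> ext <;>
          simp only [Quaternion.re_mul, Quaternion.imI_mul, Quaternion.imJ_mul,
            Quaternion.imK_mul] <;> simp [i, j]
      obtain ⟨i, j, hi, hj, hiJ, hiK, hjI⟩ := hu
      obtain ⟨a, b, hab⟩ := h i hi x 0
      obtain ⟨c, d, hcd⟩ := h j hj x 0
      rw [zero_smul, add_zero] at hab hcd
      refine ⟨?_, ?_, ?_⟩
      · rw [hcd]; simp [hjI]
      · rw [hab]; simp [hiJ]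
      · rw [hab]; simp [hiK]
    let fI : ℍ →ₗ[ℝ] ℝ := { toFun := fun a => a.imI, map_add' := by simp, map_smul' := by simp }
    let fJ : ℍ →ₗ[ℝ] ℝ := { toFun := fun a => a.imJ, map_add' := by simp, map_smul' := by simp }
    let fK : ℍ →ₗ[ℝ] ℝ := { toFun := fun a => a.imK, map_add' := by simp, map_smul' := by simp }
    have hI := comp fI fun x => (key x).1
    have hJ := comp fJ fun x => (key x).2.1
    have hK := comp fK fun x => (key x).2.2
    refine ⟨∑ k ∈ Finset.range (p.natDegree + 1), Polynomial.monomial k (p.coeff k).re, ?_⟩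
    ext1 n
    rw [Polynomial.coeff_map, Polynomial.finsetSum_coeff]
    simp only [Polynomial.coeff_monomial, Finset.sum_ite_eq', Finset.mem_range]
    split_ifs with hn
    · have h1 : (p.coeff n).imI = 0 := hI n
      have h2 : (p.coeff n).imJ = 0 := hJ n
      have h3 : (p.coeff n).imK = 0 := hK n
      ext <;> simp [Quaternion.algebraMap_def, h1, h2, h3]
    · rw [Polynomial.coeff_eq_zero_of_natDegree_lt (by omega), map_zero]
  · rintro ⟨p₀, rfl⟩ i hi u v
    rw [Polynomial.eval_map_algebraMap]
    induction p₀ using Polynomial.induction_on' with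
    | add p q hp hq =>
      obtain ⟨a, b, h⟩ := hp
      obtain ⟨c, d, h'⟩ := hq
      exact ⟨a + c, b + d, by rw [map_add, h, h', Quaternion.coe_add, add_smul]; abel⟩
    | monomial n r =>
      rw [Polynomial.aeval_monomial, Quaternion.algebraMap_def]
      suffices h : ∃ a b : ℝ, ((u : ℍ) + v • i) ^ n = (a : ℍ) + b • i by
        obtain ⟨a, b, h⟩ := h
        exact ⟨r * a, r * b, by
          rw [h, mul_add, Quaternion.coe_mul, Quaternion.coe_mul_eq_smul r (b • i), smul_smul]⟩
      induction n with
      | zero => exact ⟨1, 0, by simp⟩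
      | succ n ih =>
        obtain ⟨a, b, h⟩ := ih
        refine ⟨a * u - b * v, a * v + b * u, ?_⟩
        rw [pow_succ, h, add_mul, mul_add, mul_add, smul_mul_smul_comm, hi,
          Quaternion.mul_coe_eq_smul, Quaternion.mul_coe_eq_smul, Quaternion.coe_mul_eq_smul,
          smul_smul, smul_smul, Quaternion.coe_sub, Quaternion.coe_mul, Quaternion.coe_mul,
          Quaternion.mul_coe_eq_smul, Quaternion.mul_coe_eq_smul, add_smul, mul_comm u b, smul_neg]
        rw [show (b * v) • (1 : ℍ) = v • (b : ℍ) by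
          ext <;> simp [mul_comm]]
        abel

/-- The quaternionic poles of an intrinsic rational function: the zeros of its denominator in lowest
terms. -/
def poleSet (R : RatFunc ℝ) : Set ℍ :=
  {q | Polynomial.aeval q R.denom = 0}

open Classical in
/-- `R` as a map of `ℍ ∪ {∞}` to itself. A pole is mapped to `∞`, and
`R(∞)` is the limit of `R(q)` as `|q| → ∞`, i.e. `∞` if the numerator has the larger degree, and
otherwise the coefficient of `q ^ m` in the numerator, where `q ^ m` is the leading term of the
(monic) denominator. -/
noncomputable def ratExt (R : RatFunc ℝ) : OnePoint ℍ → OnePoint ℍ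
  | some q =>
    if q ∈ poleSet R then OnePoint.infty
    else ((Polynomial.aeval q R.num * (Polynomial.aeval q R.denom)⁻¹ : ℍ) : OnePoint ℍ)
  | none =>
    if R.denom.natDegree < R.num.natDegree then OnePoint.infty
    else (((R.num.coeff R.denom.natDegree : ℝ) : ℍ) : OnePoint ℍ)

/-! ### Polynomials of a partially defined linear map

A partially defined operator is represented by its domain `D` and a linear map `τ` on the whole space
that extends it. -/

/-! The coefficients are real, so only the real-linear structure matters, and left and right
operators are treated alike. Extend T to a real-linear map τ of all of V (`exists_isRestrict`). Then
P(T) is the restriction of P(τ) to D(T^deg P). Polynomials in τ commute, so only domains need care,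
and these are governed by `mem_iterDom_of_aeval_mem`: P(T)v ∈ D(T^n) forces v ∈ D(T^(deg P + n)).

A denominator without zeros on the S-spectrum is bijective (`BijPoly.of_forall_sPoly`): each
irreducible factor divides some x² - 2 Re(s) x + |s|² with s in the resolvent set, and bijectivity
passes to divisors and products. Hence the graph of R(T) is {(Q(τ)y, P(τ)y)} with y in D(T^max(deg
P, deg Q)). Products and sums have similar parametrizations (`quotRel_comp_iff`, `quotRel_add_iff`),
and (iii) and (iv) become comparisons of degrees.

For (i), division by the quadratic polynomial of a resolvent point shows that every P(T) is closed
(`isClosed_polyGraph`). For (ii), let t = R(s); then N = P² - 2 Re(t) PQ + |t|² Q² vanishes at s. If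
t were in the resolvent set of R(T), all nonzero divisors of N would be bijective, and s would be in
the resolvent set of T. At ∞ a degree count shows that if R(∞) were missed, T would be everywhere
defined, hence bounded by the closed graph theorem. -/

section IterDom

open Polynomial

variable {K V : Type*} [Field K] [AddCommGroup V] [Module K V]

/-- The domain of the `n`-th power of the restriction of `τ` to `D`. -/
def iterDom (D : Submodule K V) (τ : Module.End K V) (n : ℕ) : Submodule K V where
  carrier := {v | ∀ k < n, (τ ^ k) v ∈ D}
  add_mem' ha hb k hk := by rw [map_add]; exact D.add_mem (ha k hk) (hb k hk)
  zero_mem' k _ := by rw [map_zero]; exact D.zero_mem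
  smul_mem' c x hx k hk := by rw [map_smul]; exact D.smul_mem c (hx k hk)

variable {D : Submodule K V} {τ : Module.End K V}

theorem mem_iterDom {n : ℕ} {v : V} : v ∈ iterDom D τ n ↔ ∀ k < n, (τ ^ k) v ∈ D := Iff.rfl

theorem mem_iterDom_zero (v : V) : v ∈ iterDom D τ 0 := fun _ hk => absurd hk (Nat.not_lt_zero _)

theorem mem_iterDom_one {v : V} : v ∈ iterDom D τ 1 ↔ v ∈ D := by
  simp [mem_iterDom]

theorem mem_iterDom_of_le {m n : ℕ} {v : V} (h : v ∈ iterDom D τ n) (hmn : m ≤ n) :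
    v ∈ iterDom D τ m := fun k hk => h k (hk.trans_le hmn)

theorem mem_iterDom_max {m n : ℕ} {v : V} (hm : v ∈ iterDom D τ m) (hn : v ∈ iterDom D τ n) :
    v ∈ iterDom D τ (max m n) := by
  rcases max_choice m n with h | h <;> rwa [h]

theorem mem_iterDom_succ {n : ℕ} {v : V} :
    v ∈ iterDom D τ (n + 1) ↔ v ∈ iterDom D τ n ∧ (τ ^ n) v ∈ D := by
  simp only [mem_iterDom, Nat.lt_succ_iff_lt_or_eq, or_imp, forall_and, forall_eq]

theorem pow_mem_iterDom {n m k : ℕ} {v : V} (h : v ∈ iterDom D τ m) (hm : n + k ≤ m) :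
    (τ ^ k) v ∈ iterDom D τ n := by
  intro j hj
  rw [← Module.End.mul_apply, ← pow_add]
  exact h _ (by omega)

theorem aeval_mem_iterDom {n m : ℕ} {v : V} {P : K[X]} (h : v ∈ iterDom D τ m)
    (hm : P.natDegree + n ≤ m) : aeval τ P v ∈ iterDom D τ n := by
  rw [aeval_eq_sum_range, LinearMap.sum_apply]
  refine Submodule.sum_mem _ fun i hi => Submodule.smul_mem _ _ (pow_mem_iterDom h ?_)
  rw [Finset.mem_range] at hi
  omega

/-- If `P(τ)v` lies in the domain of the `n`-th power, then so does `τ ^ deg P v`. -/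
theorem mem_iterDom_of_aeval_mem {n : ℕ} {v : V} {P : K[X]} (hP : P ≠ 0)
    (h : v ∈ iterDom D τ P.natDegree) (hn : aeval τ P v ∈ iterDom D τ n) :
    v ∈ iterDom D τ (P.natDegree + n) := by
  induction n with
  | zero => exact h
  | succ n ih =>
    rw [mem_iterDom_succ] at hn
    have hv := ih hn.1
    rw [← add_assoc, mem_iterDom_succ]
    refine ⟨hv, ?_⟩
    -- Apply τ^n to P(τ)v. All terms but the leading one lie in D by the induction hypothesis, hence
    -- so does the leading one, whose coefficient is invertible.
    have h1 := hn.2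
    rw [aeval_eq_sum_range, Finset.sum_range_succ, LinearMap.add_apply, map_add,
      LinearMap.sum_apply, map_sum] at h1
    have h2 : ∑ i ∈ Finset.range P.natDegree, (τ ^ n) ((P.coeff i • τ ^ i) v) ∈ D := by
      refine Submodule.sum_mem _ fun i hi => ?_
      rw [Finset.mem_range] at hi
      rw [LinearMap.smul_apply, map_smul, ← Module.End.mul_apply, ← pow_add]
      exact D.smul_mem _ (hv _ (by omega))
    have h3 := (D.add_mem_iff_right h2).1 h1
    rw [LinearMap.smul_apply, map_smul, ← Module.End.mul_apply, ← pow_add,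
      D.smul_mem_iff (s := P.coeff P.natDegree) (leadingCoeff_ne_zero.2 hP), add_comm] at h3
    exact h3

theorem aeval_mul_apply (P Q : K[X]) (v : V) : aeval τ (P * Q) v = aeval τ P (aeval τ Q v) := by
  rw [map_mul, Module.End.mul_apply]

theorem aeval_comm_apply (P Q : K[X]) (v : V) :
    aeval τ P (aeval τ Q v) = aeval τ Q (aeval τ P v) := by
  rw [← aeval_mul_apply, mul_comm, aeval_mul_apply]

variable (D τ) in
/-- `P(τ)` maps the domain of the power of exponent `deg P` bijectively onto the space. -/
structure BijPoly (P : K[X]) : Prop where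
  ne_zero : P ≠ 0
  inj : ∀ v ∈ iterDom D τ P.natDegree, aeval τ P v = 0 → v = 0
  surj : ∀ w, ∃ v ∈ iterDom D τ P.natDegree, aeval τ P v = w

namespace BijPoly

variable {P Q : K[X]}

theorem eq_of_aeval_eq (h : BijPoly D τ P) {v w : V} (hv : v ∈ iterDom D τ P.natDegree)
    (hw : w ∈ iterDom D τ P.natDegree) (hvw : aeval τ P v = aeval τ P w) : v = w :=
  sub_eq_zero.1 (h.inj _ (Submodule.sub_mem _ hv hw) (by rw [map_sub, hvw, sub_self]))

theorem exists_preimage (h : BijPoly D τ P) {n : ℕ} {w : V} (hw : w ∈ iterDom D τ n) :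
    ∃ v ∈ iterDom D τ (P.natDegree + n), aeval τ P v = w := by
  obtain ⟨v, hv, rfl⟩ := h.surj w
  exact ⟨v, mem_iterDom_of_aeval_mem h.ne_zero hv hw, rfl⟩

/-- Injectivity is known only on the smaller domain of PQ, but a kernel vector of P lies in all
iterated domains, since its image 0 does. -/
theorem of_mul_left (h : BijPoly D τ (P * Q)) : BijPoly D τ P := by
  have hP := left_ne_zero_of_mul h.ne_zero
  have hQ := right_ne_zero_of_mul h.ne_zero
  refine ⟨hP, fun v hv h0 => h.inj v ?_ ?_, fun w => ?_⟩
  · rw [natDegree_mul hP hQ]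
    exact mem_iterDom_of_aeval_mem hP hv (by rw [h0]; exact Submodule.zero_mem _)
  · rw [mul_comm, aeval_mul_apply, h0, map_zero]
  · obtain ⟨v, hv, rfl⟩ := h.surj w
    rw [natDegree_mul hP hQ] at hv
    exact ⟨aeval τ Q v, aeval_mem_iterDom hv (by omega), (aeval_mul_apply _ _ _).symm⟩

theorem of_dvd (h : BijPoly D τ P) (hQ : Q ∣ P) : BijPoly D τ Q := by
  obtain ⟨F, rfl⟩ := hQ
  exact h.of_mul_left

theorem mul (hP : BijPoly D τ P) (hQ : BijPoly D τ Q) : BijPoly D τ (P * Q) := by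
  have hd := natDegree_mul hP.ne_zero hQ.ne_zero
  refine ⟨mul_ne_zero hP.ne_zero hQ.ne_zero, fun v hv h0 => ?_, fun w => ?_⟩
  · rw [hd] at hv
    rw [aeval_mul_apply] at h0
    exact hQ.inj v (mem_iterDom_of_le hv (by omega))
      (hP.inj _ (aeval_mem_iterDom hv (by omega)) h0)
  · obtain ⟨u, hu, rfl⟩ := hP.surj w
    obtain ⟨v, hv, rfl⟩ := hQ.exists_preimage hu
    exact ⟨v, mem_iterDom_of_le hv (by omega), aeval_mul_apply _ _ _⟩

theorem of_isUnit (hP : IsUnit P) : BijPoly D τ P := by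
  obtain ⟨c, hc, rfl⟩ := isUnit_iff.1 hP
  refine ⟨hP.ne_zero, fun v _ h => ?_, fun w => ⟨c⁻¹ • w, ?_, ?_⟩⟩
  · rw [aeval_C, Module.algebraMap_end_apply] at h
    exact (smul_eq_zero.1 h).resolve_left hc.ne_zero
  · rw [natDegree_C]; exact mem_iterDom_zero _
  · rw [aeval_C, Module.algebraMap_end_apply, smul_inv_smul₀ hc.ne_zero]

end BijPoly

/-! ### Quotients of polynomials -/

variable (D τ) in
/-- `w = P(τ)Q(τ)⁻¹v`. -/
def QuotRel (P Q : K[X]) (v w : V) : Prop :=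
  ∃ y ∈ iterDom D τ (max P.natDegree Q.natDegree), aeval τ Q y = v ∧ aeval τ P y = w

/-- F(τ) maps D(T^(deg F + m)) onto D(T^m), so y may be replaced by F(τ)z. This makes the graph of a
quotient independent of the representing fraction. -/
theorem quotRel_mul_right {P Q F : K[X]} (hF : BijPoly D τ F) (hQ : Q ≠ 0) (v w : V) :
    QuotRel D τ (P * F) (Q * F) v w ↔ QuotRel D τ P Q v w := by
  have hdQ := natDegree_mul hQ hF.ne_zero
  have hdP : max (P * F).natDegree (Q * F).natDegree = F.natDegree + max P.natDegree Q.natDegree := by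
    rcases eq_or_ne P 0 with rfl | hP
    · rw [zero_mul, natDegree_zero, hdQ]; omega
    · rw [natDegree_mul hP hF.ne_zero, hdQ]; omega
  unfold QuotRel
  rw [hdP]
  constructor
  · rintro ⟨y, hy, rfl, rfl⟩
    exact ⟨aeval τ F y, aeval_mem_iterDom hy le_rfl, (aeval_mul_apply _ _ _).symm,
      (aeval_mul_apply _ _ _).symm⟩
  · rintro ⟨y, hy, rfl, rfl⟩
    obtain ⟨z, hz, rfl⟩ := hF.exists_preimage hy
    exact ⟨z, hz, aeval_mul_apply _ _ _, aeval_mul_apply _ _ _⟩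

variable {P Q P₁ Q₁ : K[X]}

/-- Write the parameter of the inner quotient as Q(τ)z. The intermediate vector is then Q(τ)P₁(τ)z,
and injectivity of Q forces the parameter of the outer quotient to be P₁(τ)z. -/
theorem quotRel_comp_iff (hQ : BijPoly D τ Q) (v w : V) :
    (∃ u, QuotRel D τ P₁ Q₁ v u ∧ QuotRel D τ P Q u w) ↔
      ∃ z ∈ iterDom D τ (Q.natDegree + max P₁.natDegree Q₁.natDegree),
        aeval τ P₁ z ∈ iterDom D τ (max P.natDegree Q.natDegree) ∧
          aeval τ (Q * Q₁) z = v ∧ aeval τ (P * P₁) z = w := by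
  constructor
  · rintro ⟨u, ⟨y₁, hy₁, rfl, rfl⟩, y, hy, hu, rfl⟩
    obtain ⟨z, hz, rfl⟩ := hQ.exists_preimage hy₁
    rw [aeval_comm_apply P₁ Q] at hu
    have hyz : y = aeval τ P₁ z := hQ.eq_of_aeval_eq (mem_iterDom_of_le hy (le_max_right _ _))
      (aeval_mem_iterDom hz (by omega)) hu
    subst hyz
    exact ⟨z, hz, hy, by rw [mul_comm, aeval_mul_apply], aeval_mul_apply _ _ _⟩
  · rintro ⟨z, hz, hz', rfl, rfl⟩
    refine ⟨aeval τ (P₁ * Q) z, ⟨aeval τ Q z, aeval_mem_iterDom hz le_rfl, ?_, ?_⟩,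
      aeval τ P₁ z, hz', ?_, ?_⟩
    · rw [mul_comm, aeval_mul_apply]
    · rw [aeval_mul_apply]
    · rw [mul_comm, aeval_mul_apply]
    · rw [aeval_mul_apply]

theorem QuotRel.mul (hQ : BijPoly D τ Q) (hQ₁ : Q₁ ≠ 0) {v w : V}
    (h : ∃ u, QuotRel D τ P₁ Q₁ v u ∧ QuotRel D τ P Q u w) :
    QuotRel D τ (P * P₁) (Q * Q₁) v w := by
  obtain ⟨z, hz, hz', rfl, rfl⟩ := (quotRel_comp_iff hQ v w).1 h
  refine ⟨z, ?_, rfl, rfl⟩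
  rw [natDegree_mul hQ.ne_zero hQ₁]
  rcases eq_or_ne P₁ 0 with rfl | hP₁
  · rw [mul_zero, natDegree_zero] at *
    exact mem_iterDom_of_le hz (by omega)
  · have h1 := mem_iterDom_of_aeval_mem hP₁ (mem_iterDom_of_le hz (by omega)) hz'
    have h2 := natDegree_mul_le (p := P) (q := P₁)
    rcases le_total (P * P₁).natDegree (Q.natDegree + Q₁.natDegree) with h | h
    · rw [max_eq_right h]; exact mem_iterDom_of_le hz (by omega)
    · rw [max_eq_left h]; exact mem_iterDom_of_le h1 (by omega)

/-- With lower case letters for degrees and P₁ ≠ 0, the composition needs z in the domain of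
exponent q + p₁, while the product provides max(p + p₁, q + q₁). The latter suffices exactly if q ≤
p or p₁ ≤ q₁. -/
theorem QuotRel.comp_of_mul (hQ : BijPoly D τ Q) (hQ₁ : Q₁ ≠ 0) (hP : P ≠ 0)
    (hd : P₁ = 0 ∨ Q.natDegree ≤ P.natDegree ∨ P₁.natDegree ≤ Q₁.natDegree) {v w : V}
    (h : QuotRel D τ (P * P₁) (Q * Q₁) v w) :
    ∃ u, QuotRel D τ P₁ Q₁ v u ∧ QuotRel D τ P Q u w := by
  rw [quotRel_comp_iff hQ]
  obtain ⟨z, hz, hv, hw⟩ := h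
  rw [natDegree_mul hQ.ne_zero hQ₁] at hz
  rcases eq_or_ne P₁ 0 with rfl | hP₁
  · refine ⟨z, mem_iterDom_of_le hz ?_, ?_, hv, hw⟩
    · rw [natDegree_zero]; omega
    · rw [map_zero, LinearMap.zero_apply]; exact Submodule.zero_mem _
  · have hd := hd.resolve_left hP₁
    rw [natDegree_mul hP hP₁] at hz
    exact ⟨z, mem_iterDom_of_le hz (by omega), aeval_mem_iterDom hz (by omega), hv, hw⟩

/-- Both quotients share one parameter z: from y = Q₁(τ)z, injectivity of Q₁ gives y₁ = Q(τ)z. The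
domain can fall short of that of the sum fraction only if leading terms cancel in the numerator. -/
theorem quotRel_add_iff (hQ : BijPoly D τ Q) (hQ₁ : BijPoly D τ Q₁) (v u : V) :
    (∃ w w₁, QuotRel D τ P Q v w ∧ QuotRel D τ P₁ Q₁ v w₁ ∧ w + w₁ = u) ↔
      ∃ z ∈ iterDom D τ (max (Q₁.natDegree + max P.natDegree Q.natDegree)
        (Q.natDegree + max P₁.natDegree Q₁.natDegree)),
        aeval τ (Q * Q₁) z = v ∧ aeval τ (P * Q₁ + P₁ * Q) z = u := by
  constructor
  · rintro ⟨w, w₁, ⟨y, hy, rfl, rfl⟩, ⟨y₁, hy₁, h₁, rfl⟩, rfl⟩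
    obtain ⟨z, hz, rfl⟩ := hQ₁.exists_preimage hy
    rw [aeval_comm_apply] at h₁
    have hyz : y₁ = aeval τ Q z := hQ₁.eq_of_aeval_eq (mem_iterDom_of_le hy₁ (le_max_right _ _))
      (aeval_mem_iterDom hz (by omega)) h₁
    subst hyz
    refine ⟨z, mem_iterDom_max hz (mem_iterDom_of_aeval_mem hQ.ne_zero
      (mem_iterDom_of_le hz (by omega)) hy₁), aeval_mul_apply _ _ _, ?_⟩
    rw [map_add, LinearMap.add_apply, aeval_mul_apply, aeval_mul_apply]
  · rintro ⟨z, hz, rfl, rfl⟩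
    refine ⟨_, _, ⟨aeval τ Q₁ z, aeval_mem_iterDom hz (by omega), ?_, rfl⟩,
      ⟨aeval τ Q z, aeval_mem_iterDom hz (by omega), ?_, rfl⟩, ?_⟩
    · rw [aeval_mul_apply]
    · rw [mul_comm, aeval_mul_apply]
    · rw [map_add, LinearMap.add_apply, aeval_mul_apply, aeval_mul_apply]

theorem QuotRel.add (hQ : BijPoly D τ Q) (hQ₁ : BijPoly D τ Q₁) {v u : V}
    (h : ∃ w w₁, QuotRel D τ P Q v w ∧ QuotRel D τ P₁ Q₁ v w₁ ∧ w + w₁ = u) :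
    QuotRel D τ (P * Q₁ + P₁ * Q) (Q * Q₁) v u := by
  obtain ⟨z, hz, hv, hu⟩ := (quotRel_add_iff hQ hQ₁ v u).1 h
  refine ⟨z, mem_iterDom_of_le hz ?_, hv, hu⟩
  have h1 := natDegree_add_le (P * Q₁) (P₁ * Q)
  have h2 := natDegree_mul_le (p := P) (q := Q₁)
  have h3 := natDegree_mul_le (p := P₁) (q := Q)
  have h4 := natDegree_mul_le (p := Q) (q := Q₁)
  omega

theorem QuotRel.exists_of_add (hQ : BijPoly D τ Q) (hQ₁ : BijPoly D τ Q₁) (hP : P ≠ 0)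
    (hd : (P * Q₁ + P₁ * Q).natDegree = max (P * Q₁).natDegree (P₁ * Q).natDegree) {v u : V}
    (h : QuotRel D τ (P * Q₁ + P₁ * Q) (Q * Q₁) v u) :
    ∃ w w₁, QuotRel D τ P Q v w ∧ QuotRel D τ P₁ Q₁ v w₁ ∧ w + w₁ = u := by
  obtain ⟨z, hz, hv, hu⟩ := h
  refine (quotRel_add_iff hQ hQ₁ v u).2 ⟨z, mem_iterDom_of_le hz ?_, hv, hu⟩
  rw [hd, natDegree_mul hP hQ₁.ne_zero, natDegree_mul hQ.ne_zero hQ₁.ne_zero]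
  rcases eq_or_ne P₁ 0 with rfl | hP₁
  · rw [natDegree_zero]; omega
  · rw [natDegree_mul hP₁ hQ.ne_zero]; omega

end IterDom

/-! ### Closedness of polynomials of a closed operator -/

section Closed

open Polynomial

variable {V : Type*} [NormedAddCommGroup V] [NormedSpace ℝ V]

/-- The graph of `P(τ)` on its natural domain. -/
def polyGraph (D : Submodule ℝ V) (τ : Module.End ℝ V) (P : ℝ[X]) : Set (V × V) :=
  {x | x.1 ∈ iterDom D τ P.natDegree ∧ aeval τ P x.1 = x.2}

variable {D : Submodule ℝ V} {τ : Module.End ℝ V}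

theorem isClosed_polyGraph_of_natDegree_eq_zero {P : ℝ[X]} (hP : P.natDegree = 0) :
    IsClosed (polyGraph D τ P) := by
  obtain ⟨c, rfl⟩ := natDegree_eq_zero.1 hP
  have h : polyGraph D τ (C c) = {x | c • x.1 = x.2} := by
    ext x
    simp only [polyGraph, Set.mem_ofPred_eq, natDegree_C, aeval_C, Module.algebraMap_end_apply,
      mem_iterDom_zero, true_and]
  rw [h]
  exact isClosed_eq (by fun_prop) (by fun_prop)

theorem isClosed_polyGraph_of_natDegree_eq_one (hT : IsClosed {x : V × V | x.1 ∈ D ∧ τ x.1 = x.2})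
    {P : ℝ[X]} (hP : P.natDegree = 1) : IsClosed (polyGraph D τ P) := by
  obtain ⟨a, ha, b, rfl⟩ := natDegree_eq_one.1 hP
  have h : polyGraph D τ (C a * X + C b) =
      (fun x : V × V => (x.1, a⁻¹ • (x.2 - b • x.1))) ⁻¹' {x : V × V | x.1 ∈ D ∧ τ x.1 = x.2} := by
    ext x
    simp only [polyGraph, Set.mem_ofPred_eq, hP, mem_iterDom_one, Set.mem_preimage, map_add, map_mul,
      aeval_C, aeval_X, LinearMap.add_apply, Module.End.mul_apply, Module.algebraMap_end_apply]
    rw [eq_inv_smul_iff₀ ha, eq_sub_iff_add_eq]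
  rw [h]
  exact hT.preimage (by fun_prop)

/-- A closed operator with a quadratic polynomial that has a bounded inverse has only closed
polynomials. -/
theorem isClosed_polyGraph [CompleteSpace V]
    (hT : IsClosed {x : V × V | x.1 ∈ D ∧ τ x.1 = x.2}) {M : ℝ[X]}
    (hM : M.Monic) (hM2 : M.natDegree = 2) (hb : BijPoly D τ M) (B : V →L[ℝ] V)
    (hB : ∀ w, B w ∈ iterDom D τ 2) (hMB : ∀ w, aeval τ M (B w) = w) (P : ℝ[X]) :
    IsClosed (polyGraph D τ P) := by
  have hBM : ∀ v ∈ iterDom D τ 2, B (aeval τ M v) = v := fun v hv =>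
    hb.eq_of_aeval_eq (by rw [hM2]; exact hB _) (by rwa [hM2]) (hMB _)
  -- B commutes with T: for v ∈ D the vector Bv lies in D(T³), so TBv is in the domain on which B
  -- inverts M.
  have hBτ : ∀ v ∈ D, B (τ v) = τ (B v) := by
    intro v hv
    have h3 : B v ∈ iterDom D τ (2 + 1) := by
      rw [← hM2]
      refine mem_iterDom_of_aeval_mem hM.ne_zero (by rw [hM2]; exact hB v) ?_
      rwa [hMB, mem_iterDom_one]
    have h4 : τ (B v) ∈ iterDom D τ 2 := by
      simpa using pow_mem_iterDom (k := 1) h3 le_rfl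
    rw [← hBM _ h4]
    congr 1
    have := aeval_comm_apply (τ := τ) M X (B v)
    rw [aeval_X, hMB] at this
    exact this.symm
  -- TB is everywhere defined with closed graph, hence bounded.
  have hcont : Continuous (τ ∘ₗ (B : V →ₗ[ℝ] V)) := by
    refine LinearMap.continuous_of_isClosed_graph _ ?_
    have h : ((τ ∘ₗ (B : V →ₗ[ℝ] V)).graph : Set (V × V)) =
        (fun x : V × V => (B x.1, x.2)) ⁻¹' {x : V × V | x.1 ∈ D ∧ τ x.1 = x.2} := by
      ext x
      have hx : B x.1 ∈ D := mem_iterDom_one.1 (mem_iterDom_of_le (hB x.1) one_le_two)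
      simp [LinearMap.mem_graph_iff, hx, eq_comm]
    rw [h]
    exact hT.preimage (by fun_prop)
  have hcont' : Continuous fun v => τ (B v) := hcont
  induction hn : P.natDegree using Nat.strong_induction_on generalizing P with
  | _ n ih =>
    rcases Nat.lt_or_ge n 2 with hlt | hge
    · interval_cases n
      · exact isClosed_polyGraph_of_natDegree_eq_zero hn
      · exact isClosed_polyGraph_of_natDegree_eq_one hT hn
    · have hr := natDegree_modByMonic_lt P hM (by rintro rfl; simp at hM2)
      have hPF := modByMonic_add_div P M
      obtain ⟨a, b, hab⟩ := exists_eq_X_add_C_of_natDegree_le_one (p := P %ₘ M) (by omega)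
      have hFd : (P /ₘ M).natDegree = n - 2 := by rw [natDegree_divByMonic P hM, hn, hM2]
      rw [hab] at hPF
      have hF0 : P /ₘ M ≠ 0 := by
        intro h
        rw [h, mul_zero, add_zero] at hPF
        have h1 := natDegree_linear_le (a := a) (b := b)
        rw [hPF] at h1
        omega
      generalize P /ₘ M = F at hPF hFd hF0
      have hPv : ∀ v, aeval τ P v = aeval τ M (aeval τ F v) + a • τ v + b • v := by
        intro v
        rw [← hPF, map_add, LinearMap.add_apply, aeval_mul_apply, map_add, map_mul, aeval_C, aeval_C,
          aeval_X, LinearMap.add_apply, Module.End.mul_apply, Module.algebraMap_end_apply,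
          Module.algebraMap_end_apply]
        abel
      -- Since P = MF + aX + b, applying B to P(T)v = w gives F(T)v = Bw - aTBv - bBv. The right
      -- side is continuous in (v, w), and F has degree n - 2.
      have h : polyGraph D τ P = (fun x : V × V => (x.1, B x.2 - a • τ (B x.1) - b • B x.1)) ⁻¹'
          polyGraph D τ F := by
        ext ⟨v, w⟩
        simp only [polyGraph, Set.mem_ofPred_eq, Set.mem_preimage, hn, hFd]
        constructor
        · rintro ⟨hv, rfl⟩
          refine ⟨mem_iterDom_of_le hv (by omega), ?_⟩
          rw [hPv, map_add, map_add, hBM _ (aeval_mem_iterDom hv (by omega)), map_smul, map_smul,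
            hBτ _ (mem_iterDom_one.1 (mem_iterDom_of_le hv (by omega)))]
          abel
        · rintro ⟨hv, hu⟩
          have h1 : τ (B v) ∈ iterDom D τ 1 := by
            simpa using pow_mem_iterDom (k := 1) (hB v) le_rfl
          -- Regularity is regained in two rounds. The case k = 1 is free and gives v ∈ D; then TBv
          -- = BTv lies in D(T²), and k = 2 gives v ∈ D(T^n).
          have hstep : ∀ k ≤ 2, τ (B v) ∈ iterDom D τ k → v ∈ iterDom D τ (n - 2 + k) := by
            intro k hk hk'
            rw [← hFd] at hv ⊢
            refine mem_iterDom_of_aeval_mem hF0 hv ?_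
            rw [hu]
            exact Submodule.sub_mem _ (Submodule.sub_mem _ (mem_iterDom_of_le (hB w) hk)
              (Submodule.smul_mem _ _ hk')) (Submodule.smul_mem _ _ (mem_iterDom_of_le (hB v) hk))
          have hvD : v ∈ D :=
            mem_iterDom_one.1 (mem_iterDom_of_le (hstep 1 one_le_two h1) (by omega))
          have h2 : τ (B v) ∈ iterDom D τ 2 := by
            rw [← hBτ v hvD]; exact hB _
          refine ⟨mem_iterDom_of_le (hstep 2 le_rfl h2) (by omega), ?_⟩
          rw [hPv, hu, ← hBτ v hvD, map_sub, map_sub, map_smul, map_smul, hMB, hMB, hMB]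
          abel
      rw [h]
      exact (ih (n - 2) (by omega) F hFd).preimage (continuous_fst.prodMk
        (((B.continuous.comp continuous_snd).sub ((hcont'.comp continuous_fst).const_smul a)).sub
          ((B.continuous.comp continuous_fst).const_smul b)))

end Closed

/-! ### The polynomial of a sphere -/

section SPoly

open Polynomial

/-- The polynomial `x² - 2 Re(s) x + |s|²`. -/
noncomputable def sPoly (s : ℍ) : ℝ[X] := X ^ 2 + (C (-(2 * s.re)) * X + C (‖s‖ ^ 2))

theorem natDegree_sPoly (s : ℍ) : (sPoly s).natDegree = 2 := by
  unfold sPoly; compute_degree!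

theorem monic_sPoly (s : ℍ) : (sPoly s).Monic := by
  unfold sPoly; monicity!

theorem aeval_sPoly {A : Type*} [Ring A] [Algebra ℝ A] (s : ℍ) (a : A) :
    aeval a (sPoly s) = a ^ 2 + (-(2 * s.re)) • a + (‖s‖ ^ 2) • (1 : A) := by
  simp only [sPoly, map_add, map_mul, aeval_X_pow, aeval_X, aeval_C, Algebra.algebraMap_eq_smul_one,
    smul_mul_assoc, one_mul, add_assoc]

theorem aeval_self_sPoly (s : ℍ) : aeval s (sPoly s) = 0 := by
  rw [aeval_sPoly, sq ‖s‖, ← Quaternion.normSq_eq_norm_mul_self, Quaternion.normSq_def', sq]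
  ext <;> simp <;> ring

/-- A real polynomial that vanishes at `s` has a divisor whose power is the polynomial of `s`. -/
theorem exists_dvd_of_aeval_eq_zero {s : ℍ} {N : ℝ[X]} (hN : aeval s N = 0) :
    ∃ m, m ∣ N ∧ (m = sPoly s ∨ m * m = sPoly s) := by
  by_cases hs : s = (s.re : ℍ)
  -- For real s the quadratic polynomial is (X - s)², of which only one factor need divide N.
  · refine ⟨X - C s.re, dvd_iff_isRoot.2 ?_, Or.inr ?_⟩
    · rw [hs, ← Quaternion.algebraMap_def, aeval_algebraMap_apply,
        FaithfulSMul.algebraMap_eq_zero_iff] at hN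
      exact hN
    · have h : ‖s‖ ^ 2 = s.re ^ 2 := by
        conv_lhs => rw [hs]
        rw [Quaternion.norm_coe, Real.norm_eq_abs, sq_abs]
      rw [sPoly, h]
      simp only [map_neg, map_mul, map_pow]
      rw [show (C 2 : ℝ[X]) = 2 from rfl]
      ring
  · refine ⟨sPoly s, ?_, Or.inl rfl⟩
    rw [← modByMonic_eq_zero_iff_dvd (monic_sPoly s)]
    have hd := natDegree_modByMonic_lt N (monic_sPoly s)
      (by intro h; simpa [h] using natDegree_sPoly s)
    rw [natDegree_sPoly] at hd
    obtain ⟨a, b, hab⟩ := exists_eq_X_add_C_of_natDegree_le_one (p := N %ₘ sPoly s) (by omega)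
    have h0 := modByMonic_add_div N (sPoly s)
    rw [hab] at h0 ⊢
    rw [← h0] at hN
    simp only [map_add, map_mul, aeval_self_sPoly, zero_mul, add_zero, aeval_C, aeval_X,
      Quaternion.algebraMap_def] at hN
    -- The remainder aX + b vanishes at the nonreal point s; comparing imaginary parts gives a = 0.
    have ha : a = 0 := by
      by_contra ha
      apply hs
      have h1 := congrArg QuaternionAlgebra.imI hN
      have h2 := congrArg QuaternionAlgebra.imJ hN
      have h3 := congrArg QuaternionAlgebra.imK hN
      simp [ha] at h1 h2 h3
      ext <;> simp [h1, h2, h3]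
    subst ha
    have hb := congrArg QuaternionAlgebra.re hN
    simp at hb
    simp [hb]

theorem BijPoly.sPoly_of_aeval_eq_zero {V : Type*} [AddCommGroup V] [Module ℝ V]
    {D : Submodule ℝ V} {τ : Module.End ℝ V} {s : ℍ} {N : ℝ[X]} (hN : aeval s N = 0)
    (h : ∀ m, m ≠ 0 → m ∣ N → BijPoly D τ m) : BijPoly D τ (sPoly s) := by
  obtain ⟨m, hm, h1 | h1⟩ := exists_dvd_of_aeval_eq_zero hN
  · rw [← h1]
    exact h m (by rw [h1]; exact (monic_sPoly s).ne_zero) hm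
  · have hm0 : m ≠ 0 := by
      rintro rfl
      exact (monic_sPoly s).ne_zero (by rw [← h1, zero_mul])
    rw [← h1]
    exact (h m hm0 hm).mul (h m hm0 hm)

/-- A polynomial without zeros on the spectrum is bijective. -/
theorem BijPoly.of_forall_sPoly {V : Type*} [AddCommGroup V] [Module ℝ V]
    {D : Submodule ℝ V} {τ : Module.End ℝ V} {Q : ℝ[X]} (hQ : Q ≠ 0)
    (h : ∀ s : ℍ, aeval s Q = 0 → BijPoly D τ (sPoly s)) : BijPoly D τ Q := by
  induction Q using WfDvdMonoid.induction_on_irreducible with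
  | zero => exact absurd rfl hQ
  | unit u hu => exact .of_isUnit hu
  | mul Q f hQ0 hf ih =>
    refine .mul ?_ (ih hQ0 fun s hs => h s (by rw [map_mul, hs, mul_zero]))
    -- A complex zero of f, viewed as a quaternion, has a minimal polynomial associated to f; it
    -- divides the quadratic polynomial of that quaternion.
    obtain ⟨z, hz⟩ := IsAlgClosed.exists_aeval_eq_zero ℂ f
      (degree_pos_of_irreducible hf).ne'
    have hzf : aeval (Quaternion.ofComplex z) f = 0 := by
      rw [aeval_algHom_apply, hz, map_zero]
    refine (h (Quaternion.ofComplex z) (by rw [map_mul, hzf, zero_mul])).of_dvd ?_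
    have hint : IsIntegral ℝ (Quaternion.ofComplex z) :=
      ⟨_, monic_sPoly _, by rw [← aeval_def]; exact aeval_self_sPoly _⟩
    have h1 := minpoly.dvd ℝ (Quaternion.ofComplex z) hzf
    have h2 := minpoly.dvd ℝ (Quaternion.ofComplex z) (aeval_self_sPoly _)
    exact ((minpoly.irreducible hint).associated_of_dvd hf h1).symm.dvd.trans h2

end SPoly

/-! ### Graphs of the operator constructions -/

section Graphs

open Polynomial

variable {A V : Type*} [Ring A] [NormedAddCommGroup V] [Module A V]

theorem mem_graph_opComp (g f : V →ₗ.[A] V) (v w : V) :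
    (v, w) ∈ (opComp g f).graph ↔ ∃ u, (v, u) ∈ f.graph ∧ (u, w) ∈ g.graph := by
  simp only [LinearPMap.mem_graph_iff]
  constructor
  · rintro ⟨⟨x, hx⟩, rfl, rfl⟩
    obtain ⟨h, h'⟩ := (mem_domain_opComp g f x).1 hx
    exact ⟨_, ⟨⟨x, h⟩, rfl, rfl⟩, ⟨_, h'⟩, rfl, (opComp_apply g f x hx h h').symm⟩
  · rintro ⟨u, ⟨⟨x, h⟩, rfl, rfl⟩, ⟨y, h'⟩, hy, rfl⟩
    dsimp only at hy
    subst hy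
    have hx := (mem_domain_opComp g f x).2 ⟨h, h'⟩
    exact ⟨⟨x, hx⟩, rfl, opComp_apply g f x hx h h'⟩

theorem mem_graph_add (g f : V →ₗ.[A] V) (v w : V) :
    (v, w) ∈ (g + f).graph ↔ ∃ x y, (v, x) ∈ g.graph ∧ (v, y) ∈ f.graph ∧ x + y = w := by
  simp only [LinearPMap.mem_graph_iff]
  constructor
  · rintro ⟨⟨x, hx, hx'⟩, rfl, rfl⟩
    exact ⟨_, _, ⟨⟨x, hx⟩, rfl, rfl⟩, ⟨⟨x, hx'⟩, rfl, rfl⟩, rfl⟩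
  · rintro ⟨x, y, ⟨⟨v, hv⟩, rfl, rfl⟩, ⟨⟨v', hv'⟩, h, rfl⟩, rfl⟩
    dsimp only at h
    subst h
    exact ⟨⟨v', hv, hv'⟩, rfl, rfl⟩

theorem mem_graph_toPMap_top (f : V →ₗ[A] V) (v w : V) :
    (v, w) ∈ (f.toPMap ⊤).graph ↔ f v = w := by
  rw [LinearPMap.mem_graph_iff]
  constructor
  · rintro ⟨⟨x, hx⟩, rfl, rfl⟩; rfl
  · rintro rfl; exact ⟨⟨v, trivial⟩, rfl, rfl⟩

theorem hasBoundedInverse_iff (L : V →ₗ.[A] V) :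
    HasBoundedInverse L ↔ ∃ B : V →L[A] V, ∀ v w, (v, w) ∈ L.graph ↔ B w = v := by
  constructor
  · rintro ⟨B, h1, h2⟩
    refine ⟨B, fun v w => ?_⟩
    rw [LinearPMap.mem_graph_iff]
    constructor
    · rintro ⟨x, rfl, rfl⟩; exact h1 x
    · rintro rfl
      obtain ⟨h, h'⟩ := h2 w
      exact ⟨⟨_, h⟩, rfl, h'⟩
  · rintro ⟨B, h⟩
    refine ⟨B, fun v => (h _ _).1 (L.mem_graph v), fun w => ?_⟩
    have hw := (h (B w) w).2 rfl
    generalize B w = v at hw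
    obtain ⟨⟨x, hx⟩, rfl, rfl⟩ := L.mem_graph_iff.1 hw
    exact ⟨hx, rfl⟩

theorem mem_graph_opPow_zero (T : V →ₗ.[A] V) (v w : V) : (v, w) ∈ (opPow T 0).graph ↔ v = w :=
  mem_graph_toPMap_top _ v w

section Restrict

variable [NormedSpace ℝ V]

/-- `f` is the restriction of the real linear map `σ` to the real subspace `D`. -/
def IsRestrict (f : V →ₗ.[A] V) (D : Submodule ℝ V) (σ : Module.End ℝ V) : Prop :=
  ∀ v w, (v, w) ∈ f.graph ↔ v ∈ D ∧ σ v = w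

variable {T : V →ₗ.[A] V} {D : Submodule ℝ V} {τ : Module.End ℝ V}

theorem IsRestrict.mem_domain (h : IsRestrict T D τ) {v : V} : v ∈ T.domain ↔ v ∈ D := by
  rw [LinearPMap.mem_domain_iff]
  simp [h v]

theorem IsRestrict.isClosed_iff (h : IsRestrict T D τ) :
    IsClosedOp T ↔ IsClosed {x : V × V | x.1 ∈ D ∧ τ x.1 = x.2} := by
  unfold IsClosedOp
  congr! 3 with x
  exact h x.1 x.2

theorem IsRestrict.opPow (h : IsRestrict T D τ) (n : ℕ) :
    IsRestrict (opPow T n) (iterDom D τ n) (τ ^ n) := by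
  induction n with
  | zero =>
    intro v w
    rw [mem_graph_opPow_zero, pow_zero, Module.End.one_apply]
    exact (and_iff_right (mem_iterDom_zero v)).symm
  | succ n ih =>
    intro v w
    change (v, w) ∈ (opComp T _).graph ↔ _
    rw [mem_graph_opComp, mem_iterDom_succ, pow_succ', Module.End.mul_apply]
    simp only [ih v, h _ w]
    constructor
    · rintro ⟨_, ⟨h1, rfl⟩, h2, h3⟩; exact ⟨⟨h1, h2⟩, h3⟩
    · rintro ⟨⟨h1, h2⟩, h3⟩; exact ⟨_, ⟨h1, rfl⟩, h2, h3⟩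

end Restrict

variable [Algebra ℝ A] [NormedSpace ℝ V] [IsScalarTower ℝ A V]

theorem mem_graph_smul (c : ℝ) (f : V →ₗ.[A] V) (v w : V) :
    (v, w) ∈ (c • f).graph ↔ ∃ u, (v, u) ∈ f.graph ∧ c • u = w := by
  simp only [LinearPMap.mem_graph_iff]
  constructor
  · rintro ⟨⟨x, hx⟩, rfl, rfl⟩
    exact ⟨_, ⟨⟨x, hx⟩, rfl, rfl⟩, rfl⟩
  · rintro ⟨u, ⟨⟨x, hx⟩, rfl, rfl⟩, rfl⟩
    exact ⟨⟨x, hx⟩, rfl, rfl⟩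

/-- Only the graph of the operator enters, which serves both T and R(T). -/
theorem mem_graph_sOp (T : V →ₗ.[A] V) (s : ℍ) (v w : V) :
    (v, w) ∈ (sOp T s).graph ↔ ∃ u x, (v, u) ∈ T.graph ∧ (u, x) ∈ T.graph ∧
      x + (-(2 * s.re)) • u + (‖s‖ ^ 2) • v = w := by
  simp only [sOp, mem_graph_add, mem_graph_smul, mem_graph_opPow_zero]
  simp only [opPow, mem_graph_opComp, mem_graph_toPMap_top, LinearMap.id_apply]
  constructor
  · rintro ⟨_, _, ⟨x, _, ⟨u, ⟨_, rfl, hu⟩, hx⟩, ⟨u', hu', rfl⟩, rfl⟩, ⟨_, rfl, rfl⟩, rfl⟩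
    obtain rfl := T.mem_graph_snd_inj hu hu' rfl
    exact ⟨u, x, hu, hx, rfl⟩
  · rintro ⟨u, x, hu, hx, rfl⟩
    exact ⟨_, _, ⟨x, _, ⟨u, ⟨v, rfl, hu⟩, hx⟩, ⟨u, hu, rfl⟩, rfl⟩, ⟨v, rfl, rfl⟩, rfl⟩

/-- The extension is purely algebraic; it need be neither continuous nor `A`-linear. -/
theorem exists_isRestrict (T : V →ₗ.[A] V) : ∃ D τ, IsRestrict T D τ := by
  obtain ⟨τ, hτ⟩ := LinearMap.exists_extend (p := T.domain.restrictScalars ℝ)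
    (T.toFun.restrictScalars ℝ)
  refine ⟨T.domain.restrictScalars ℝ, τ, fun v w => ?_⟩
  rw [LinearPMap.mem_graph_iff]
  constructor
  · rintro ⟨x, rfl, rfl⟩
    exact ⟨x.2, LinearMap.congr_fun hτ x⟩
  · rintro ⟨hv, rfl⟩
    exact ⟨⟨v, hv⟩, rfl, (LinearMap.congr_fun hτ ⟨v, hv⟩).symm⟩

variable {T : V →ₗ.[A] V} {D : Submodule ℝ V} {τ : Module.End ℝ V}

theorem IsRestrict.sum_opPow (h : IsRestrict T D τ) (c : ℕ → ℝ) (n : ℕ) :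
    IsRestrict (∑ l ∈ Finset.range (n + 1), c l • _root_.opPow T l) (iterDom D τ n)
      (∑ l ∈ Finset.range (n + 1), c l • τ ^ l) := by
  have key : ∀ k v w, (v, w) ∈ (c k • _root_.opPow T k).graph ↔
      v ∈ iterDom D τ k ∧ c k • (τ ^ k) v = w := by
    intro k v w
    rw [mem_graph_smul]
    simp only [h.opPow k v]
    constructor
    · rintro ⟨_, ⟨h1, rfl⟩, h2⟩; exact ⟨h1, h2⟩
    · rintro ⟨h1, h2⟩; exact ⟨_, ⟨h1, rfl⟩, h2⟩
  induction n with
  | zero =>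
    intro v w
    simp only [zero_add, Finset.sum_range_one]
    exact key 0 v w
  | succ n ih =>
    intro v w
    rw [Finset.sum_range_succ, mem_graph_add, Finset.sum_range_succ _ (n + 1), LinearMap.add_apply]
    simp only [ih v, key]
    constructor
    · rintro ⟨_, _, ⟨_, rfl⟩, ⟨h1, rfl⟩, h2⟩; exact ⟨h1, h2⟩
    · rintro ⟨h1, h2⟩
      exact ⟨_, _, ⟨mem_iterDom_of_le h1 (Nat.le_succ n), rfl⟩, ⟨h1, rfl⟩, h2⟩

theorem IsRestrict.polyOp (h : IsRestrict T D τ) (P : ℝ[X]) :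
    IsRestrict (polyOp P T) (iterDom D τ P.natDegree) (aeval τ P) := by
  rw [aeval_eq_sum_range]
  exact h.sum_opPow P.coeff P.natDegree

theorem IsRestrict.sOp (h : IsRestrict T D τ) (s : ℍ) :
    IsRestrict (sOp T s) (iterDom D τ (sPoly s).natDegree) (aeval τ (sPoly s)) := by
  intro v w
  rw [mem_graph_sOp, aeval_sPoly, natDegree_sPoly, mem_iterDom_succ, mem_iterDom_one, pow_one]
  simp only [h _ _]
  constructor
  · rintro ⟨_, _, ⟨h1, rfl⟩, ⟨h2, rfl⟩, rfl⟩
    exact ⟨⟨h1, h2⟩, by simp [sq]⟩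
  · rintro ⟨⟨h1, h2⟩, rfl⟩
    exact ⟨_, _, ⟨h1, rfl⟩, ⟨h2, rfl⟩, by simp [sq]⟩

theorem IsRestrict.bijPoly_of_mem (h : IsRestrict T D τ) {s : ℍ} (hs : s ∈ sResolventSet T) :
    BijPoly D τ (sPoly s) := by
  obtain ⟨B, hB⟩ := (hasBoundedInverse_iff _).1 hs
  have hB' : ∀ v w, _ := fun v w => (h.sOp s v w).symm.trans (hB v w)
  refine ⟨(monic_sPoly s).ne_zero, fun v hv h0 => ?_, fun w => ⟨B w, (hB' _ _).2 rfl⟩⟩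
  rw [← (hB' v 0).1 ⟨hv, h0⟩, map_zero]

theorem IsRestrict.isClosed_polyGraph [CompleteSpace V] (h : IsRestrict T D τ) (hT : IsClosedOp T)
    (hρ : (sResolventSet T).Nonempty) (P : ℝ[X]) : IsClosed (polyGraph D τ P) := by
  obtain ⟨s, hs⟩ := hρ
  obtain ⟨B, hB⟩ := (hasBoundedInverse_iff _).1 hs
  have hB' : ∀ w, _ := fun w => (h.sOp s (B w) w).1 ((hB _ w).2 rfl)
  exact _root_.isClosed_polyGraph (h.isClosed_iff.1 hT) (monic_sPoly s) (natDegree_sPoly s)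
    (h.bijPoly_of_mem hs) (B.restrictScalars ℝ)
    (fun w => by have := (hB' w).1; rwa [natDegree_sPoly] at this) (fun w => (hB' w).2) P

/-- A closed bijective operator has a bounded inverse. -/
theorem hasBoundedInverse_of_isClosedOp [CompleteSpace V] {L : V →ₗ.[A] V} (hL : IsClosedOp L)
    (hinj : ∀ v, (v, (0 : V)) ∈ L.graph → v = 0) (hsurj : ∀ w, ∃ v, (v, w) ∈ L.graph) :
    HasBoundedInverse L := by
  choose g hg using hsurj
  have huniq : ∀ {v w}, (v, w) ∈ L.graph → v = g w := by
    intro v w hv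
    have := L.graph.sub_mem hv (hg w)
    rw [Prod.mk_sub_mk, sub_self] at this
    exact sub_eq_zero.1 (hinj _ this)
  let B : V →ₗ[A] V :=
    { toFun := g
      map_add' := fun x y => (huniq (L.graph.add_mem (hg x) (hg y))).symm
      map_smul' := fun c x => (huniq (L.graph.smul_mem c (hg x))).symm }
  have hB : ∀ v w, (v, w) ∈ L.graph ↔ B w = v := fun v w =>
    ⟨fun h => (huniq h).symm, by rintro rfl; exact hg w⟩
  have hcont : Continuous (B.restrictScalars ℝ) := by
    refine LinearMap.continuous_of_isClosed_graph _ ?_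
    have : ((B.restrictScalars ℝ).graph : Set (V × V)) =
        Prod.swap ⁻¹' {x : V × V | x ∈ L.graph} := by
      ext ⟨x, y⟩
      simp [LinearMap.mem_graph_iff, hB, eq_comm]
    rw [this]
    exact hL.preimage continuous_swap
  exact (hasBoundedInverse_iff L).2 ⟨⟨B, hcont⟩, hB⟩

/-- By the closed graph theorem bijectivity suffices. A given resolvent point supplies the
closedness of the quadratic operator at any other s. -/
theorem IsRestrict.mem_sResolventSet_iff [CompleteSpace V] (h : IsRestrict T D τ)
    (hT : IsClosedOp T) (hρ : (sResolventSet T).Nonempty) (s : ℍ) :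
    s ∈ sResolventSet T ↔ BijPoly D τ (sPoly s) := by
  refine ⟨h.bijPoly_of_mem, fun hb => hasBoundedInverse_of_isClosedOp ?_ ?_ ?_⟩
  · exact (h.sOp s).isClosed_iff.2 (h.isClosed_polyGraph hT hρ _)
  · exact fun v hv => hb.inj v ((h.sOp s v 0).1 hv).1 ((h.sOp s v 0).1 hv).2
  · intro w
    obtain ⟨v, hv⟩ := hb.surj w
    exact ⟨v, (h.sOp s v w).2 hv⟩

theorem IsRestrict.isBoundedOp_of_forall_mem [CompleteSpace V] (h : IsRestrict T D τ)
    (hT : IsClosedOp T) (hD : ∀ v, v ∈ D) : IsBoundedOp T := by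
  have htop : T.domain = ⊤ := Submodule.eq_top_iff'.2 fun v => h.mem_domain.2 (hD v)
  have hτ : ∀ v, T ⟨v, by rw [htop]; trivial⟩ = τ v := fun v =>
    ((h _ _).1 (T.mem_graph ⟨v, _⟩)).2.symm
  let B : V →ₗ[A] V := T.toFun ∘ₗ LinearMap.id.codRestrict T.domain
    (fun v => by rw [htop]; trivial)
  have hB : ∀ v, B v = τ v := hτ
  have hgraph : ∀ v w, (v, w) ∈ T.graph ↔ B v = w := fun v w => by
    rw [h v w, hB, and_iff_right (hD v)]
  have hcont : Continuous (B.restrictScalars ℝ) := by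
    refine LinearMap.continuous_of_isClosed_graph _ ?_
    have : ((B.restrictScalars ℝ).graph : Set (V × V)) = {x : V × V | x ∈ T.graph} := by
      ext ⟨x, y⟩
      simp [LinearMap.mem_graph_iff, hgraph, eq_comm]
    rw [this]
    exact hT
  refine ⟨⟨B, hcont⟩, LinearPMap.eq_of_eq_graph ?_⟩
  ext ⟨v, w⟩
  rw [hgraph, mem_graph_toPMap_top]

end Graphs

/-! ### The rational functional calculus -/

section Calculus

open Polynomial

theorem RatFunc.exists_eq_num_mul_eq_denom_mul {K : Type*} [Field K] {R : RatFunc K} {P Q : K[X]}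
    (hQ : Q ≠ 0) (hR : R = algebraMap K[X] (RatFunc K) P / algebraMap K[X] (RatFunc K) Q) :
    ∃ F, F ≠ 0 ∧ P = R.num * F ∧ Q = R.denom * F := by
  have h : R.num * Q = P * R.denom := by
    have h1 := RatFunc.num_div_denom R
    conv_rhs at h1 => rw [hR]
    rw [div_eq_div_iff (RatFunc.algebraMap_ne_zero R.denom_ne_zero)
      (RatFunc.algebraMap_ne_zero hQ), ← map_mul, ← map_mul] at h1
    exact RatFunc.algebraMap_injective K h1
  obtain ⟨F, rfl⟩ : R.denom ∣ Q :=
    (RatFunc.isCoprime_num_denom R).symm.dvd_of_dvd_mul_left ⟨P, by rw [h, mul_comm]⟩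
  refine ⟨F, right_ne_zero_of_mul hQ, mul_right_cancel₀ R.denom_ne_zero ?_, rfl⟩
  rw [← h]; ring

/-! ### The quadratic operator of a quotient -/

section Square

variable {V : Type*} [AddCommGroup V] [Module ℝ V] {D : Submodule ℝ V} {τ : Module.End ℝ V}

/-- The numerator of `R² - 2 Re(t) R + |t|²` for `R = P Q⁻¹`. -/
noncomputable def sNum (t : ℍ) (P Q : ℝ[X]) : ℝ[X] :=
  P * P + (C (-(2 * t.re)) * (P * Q) + C (‖t‖ ^ 2) * (Q * Q))

theorem natDegree_sNum_le (t : ℍ) (P Q : ℝ[X]) :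
    (sNum t P Q).natDegree ≤ 2 * max P.natDegree Q.natDegree := by
  refine natDegree_add_le_of_degree_le (natDegree_mul_le.trans (by omega))
    (natDegree_add_le_of_degree_le ((natDegree_C_mul_le _ _).trans (natDegree_mul_le.trans (by omega)))
      ((natDegree_C_mul_le _ _).trans (natDegree_mul_le.trans (by omega))))

theorem aeval_sNum_apply (t : ℍ) (P Q : ℝ[X]) (z : V) :
    aeval τ (sNum t P Q) z = aeval τ P (aeval τ P z) + (-(2 * t.re)) • aeval τ P (aeval τ Q z) +
      (‖t‖ ^ 2) • aeval τ Q (aeval τ Q z) := by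
  simp only [sNum, map_add, map_mul, aeval_C, LinearMap.add_apply, Module.End.mul_apply,
    Module.algebraMap_end_apply, add_assoc]

/-- P(s) and Q(s) commute, so t = P(s)Q(s)⁻¹ commutes with Q(s), and the value is (t² - 2 Re(t) t +
|t|²) Q(s)² = 0. -/
theorem aeval_sNum_eq_zero {s : ℍ} {P Q : ℝ[X]} (hQ : aeval s Q ≠ 0) :
    aeval s (sNum (aeval s P * (aeval s Q)⁻¹) P Q) = 0 := by
  set t := aeval s P * (aeval s Q)⁻¹ with ht
  have h1 : aeval s P = t * aeval s Q := by rw [ht, inv_mul_cancel_right₀ hQ]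
  have h2 : aeval s Q * t = aeval s P := by
    rw [ht, ← mul_assoc, ← map_mul, mul_comm, map_mul, mul_assoc, mul_inv_cancel₀ hQ, mul_one]
  have h3 : aeval s P * aeval s P = t ^ 2 * (aeval s Q * aeval s Q) := by
    nth_rewrite 1 [h1]
    rw [← h2, sq, h2, h1, ← mul_assoc, mul_assoc t (aeval s Q) t, h2, h1]
    simp only [mul_assoc]
  have h4 := aeval_self_sPoly t
  rw [aeval_sPoly] at h4
  rw [← zero_mul (aeval s Q * aeval s Q), ← h4]
  simp only [sNum, map_add, map_mul, aeval_C]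
  rw [h3, h1, mul_assoc t]
  simp only [Algebra.algebraMap_eq_smul_one, smul_mul_assoc, one_mul, add_mul, add_assoc]

theorem exists_quotRel_sq_iff {P Q : ℝ[X]} (hQ : BijPoly D τ Q) (t : ℍ) (v w : V) :
    (∃ u x, QuotRel D τ P Q v u ∧ QuotRel D τ P Q u x ∧
      x + (-(2 * t.re)) • u + (‖t‖ ^ 2) • v = w) ↔
      ∃ z ∈ iterDom D τ (2 * max P.natDegree Q.natDegree),
        aeval τ (Q * Q) z = v ∧ aeval τ (sNum t P Q) z = w := by
  constructor
  · rintro ⟨_, _, ⟨y, hy, rfl, rfl⟩, ⟨y', hy', hu, rfl⟩, rfl⟩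
    obtain ⟨z, hz, rfl⟩ := hQ.exists_preimage hy
    have hyz : y' = aeval τ P z := by
      refine hQ.eq_of_aeval_eq (mem_iterDom_of_le hy' (le_max_right _ _))
        (aeval_mem_iterDom hz (by omega)) ?_
      rw [hu, aeval_comm_apply]
    subst hyz
    refine ⟨z, ?_, aeval_mul_apply _ _ _, aeval_sNum_apply _ _ _ _⟩
    -- If deg P > deg Q, the missing regularity of z comes from P(τ)z ∈ D(T^deg P).
    rcases le_or_gt P.natDegree Q.natDegree with h | h
    · exact mem_iterDom_of_le hz (by omega)
    · have hP : P ≠ 0 := by rintro rfl; simp at h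
      exact mem_iterDom_of_le (mem_iterDom_of_aeval_mem hP (mem_iterDom_of_le hz (by omega)) hy')
        (by omega)
  · rintro ⟨z, hz, rfl, rfl⟩
    refine ⟨_, _, ⟨aeval τ Q z, aeval_mem_iterDom hz (by omega), (aeval_mul_apply _ _ _).symm, rfl⟩,
      ⟨aeval τ P z, aeval_mem_iterDom hz (by omega), aeval_comm_apply _ _ _, rfl⟩, ?_⟩
    rw [aeval_sNum_apply, aeval_mul_apply]

/-- If `R² - 2 Re(t) R + |t|²` with `R = P Q⁻¹` is bijective, then so are the divisors of its
numerator. -/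
theorem BijPoly.of_dvd_sNum {P Q : ℝ[X]} (hQ : BijPoly D τ Q) {t : ℍ}
    (hinj : ∀ z ∈ iterDom D τ (2 * max P.natDegree Q.natDegree),
      aeval τ (sNum t P Q) z = 0 → aeval τ (Q * Q) z = 0)
    (hsurj : ∀ w, ∃ z ∈ iterDom D τ (2 * max P.natDegree Q.natDegree),
      aeval τ (sNum t P Q) z = w) {m : ℝ[X]} (hm : m ≠ 0) (hdvd : m ∣ sNum t P Q) :
    BijPoly D τ m := by
  have hdeg := natDegree_sNum_le t P Q
  obtain ⟨k, hk⟩ := hdvd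
  rw [hk] at hinj hsurj hdeg
  refine ⟨hm, fun v hv h0 => ?_, fun w => ?_⟩
  · have hmem : ∀ n, v ∈ iterDom D τ n := fun n => mem_iterDom_of_le
      (mem_iterDom_of_aeval_mem (n := n) hm hv (by rw [h0]; exact Submodule.zero_mem _))
      (Nat.le_add_left _ _)
    refine (hQ.mul hQ).inj v (hmem _) (hinj v (hmem _) ?_)
    rw [mul_comm, aeval_mul_apply, h0, map_zero]
  · obtain ⟨z, hz, rfl⟩ := hsurj w
    refine ⟨aeval τ k z, ?_, (aeval_mul_apply _ _ _).symm⟩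
    rcases eq_or_ne k 0 with rfl | hk0
    · rw [map_zero]; exact Submodule.zero_mem _
    · rw [natDegree_mul hm hk0] at hdeg
      exact aeval_mem_iterDom hz (by omega)

/-- If `R = P Q⁻¹` has the value `c` at infinity, then `(R - c)²` maps into the domain `D`. -/
theorem aeval_sNum_mem {P Q : ℝ[X]} (hQ : Q.Monic) (hd : P.natDegree ≤ Q.natDegree) {z : V}
    (hz : z ∈ iterDom D τ (2 * max P.natDegree Q.natDegree)) :
    aeval τ (sNum ((P.coeff Q.natDegree : ℝ) : ℍ) P Q) z ∈ D := by
  set c := P.coeff Q.natDegree with hc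
  -- As c is real, the numerator is a square. The choice of c cancels the coefficient of degree deg
  -- Q in P - cQ, which leaves powers of T to spare.
  have hN : sNum (c : ℍ) P Q = (P - C c * Q) * (P - C c * Q) := by
    rw [sNum, Quaternion.re_coe, Quaternion.norm_coe, Real.norm_eq_abs, sq_abs]
    simp only [map_neg, map_mul, map_pow]
    rw [show (C 2 : ℝ[X]) = 2 from rfl]
    ring
  rw [hN]
  rcases eq_or_ne (P - C c * Q) 0 with h0 | h0
  · rw [h0, zero_mul, map_zero]; exact D.zero_mem
  · have h1 : (P - C c * Q).natDegree ≤ Q.natDegree :=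
      (natDegree_sub_le _ _).trans (max_le hd (natDegree_C_mul_le _ _))
    have h2 : (P - C c * Q).natDegree ≠ Q.natDegree := by
      intro h
      apply leadingCoeff_ne_zero.2 h0
      rw [leadingCoeff, h, coeff_sub, coeff_C_mul, hQ.coeff_natDegree, mul_one, hc, sub_self]
    have h3 := natDegree_mul_le (p := P - C c * Q) (q := P - C c * Q)
    exact mem_iterDom_one.1 (aeval_mem_iterDom hz (by omega))

end Square

/-! ### Graphs, products and sums of rational functions of T -/

variable {A V : Type*} [Ring A] [NormedAddCommGroup V] [Module A V] [Algebra ℝ A]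
  [NormedSpace ℝ V] [IsScalarTower ℝ A V] {T : V →ₗ.[A] V} {D : Submodule ℝ V}
  {τ : Module.End ℝ V}

theorem IsRestrict.bijPoly_denom (h : IsRestrict T D τ) {R : RatFunc ℝ}
    (hR : Disjoint (poleSet R) (sSpectrum T)) : BijPoly D τ R.denom :=
  .of_forall_sPoly R.denom_ne_zero fun _ hs =>
    h.bijPoly_of_mem (Set.notMem_compl_iff.1 (Set.disjoint_left.1 hR hs))

theorem IsRestrict.mem_graph_inverse_polyOp (h : IsRestrict T D τ) {Q : ℝ[X]}
    (hQ : BijPoly D τ Q) (v w : V) :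
    (v, w) ∈ (_root_.polyOp Q T).inverse.graph ↔ w ∈ iterDom D τ Q.natDegree ∧ aeval τ Q w = v := by
  rw [LinearPMap.inverse_graph, ← h.polyOp Q w v]
  · constructor
    · rintro ⟨⟨a, b⟩, hab, hab'⟩
      cases hab'
      exact hab
    · exact fun hab => ⟨(w, v), hab, rfl⟩
  -- `LinearPMap.inverse` has the expected graph only for an injective operator.
  · refine LinearMap.ker_eq_bot'.2 fun x hx => ?_
    have := (h.polyOp Q _ _).1 ((_root_.polyOp Q T).mem_graph x)
    exact Subtype.ext (hQ.inj _ this.1 (this.2.trans hx))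

theorem IsRestrict.mem_graph_ratOp (h : IsRestrict T D τ) {R : RatFunc ℝ}
    (hR : BijPoly D τ R.denom) (v w : V) :
    (v, w) ∈ (ratOp R T).graph ↔ QuotRel D τ R.num R.denom v w := by
  rw [ratOp, mem_graph_opComp]
  simp only [h.mem_graph_inverse_polyOp hR, h.polyOp R.num _ _]
  constructor
  · rintro ⟨u, ⟨h1, rfl⟩, h2, rfl⟩
    exact ⟨u, mem_iterDom_max h2 h1, rfl, rfl⟩
  · rintro ⟨u, hu, rfl, rfl⟩
    exact ⟨u, ⟨mem_iterDom_of_le hu (le_max_right _ _), rfl⟩,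
      mem_iterDom_of_le hu (le_max_left _ _), rfl⟩

/-- The graph of `R(T)` for a quotient that is not necessarily in lowest terms. -/
theorem IsRestrict.mem_graph_ratOp_of_eq_div (h : IsRestrict T D τ) {R : RatFunc ℝ} {P Q : ℝ[X]}
    (hQ : BijPoly D τ Q)
    (hR : R = algebraMap ℝ[X] (RatFunc ℝ) P / algebraMap ℝ[X] (RatFunc ℝ) Q) (v w : V) :
    (v, w) ∈ (ratOp R T).graph ↔ QuotRel D τ P Q v w := by
  obtain ⟨F, -, hP, hQF⟩ := RatFunc.exists_eq_num_mul_eq_denom_mul hQ.ne_zero hR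
  rw [h.mem_graph_ratOp (hQ.of_dvd ⟨F, hQF⟩), hP, hQF,
    quotRel_mul_right (hQ.of_dvd ⟨R.denom, by rw [hQF, mul_comm]⟩) R.denom_ne_zero]

theorem IsRestrict.mem_graph_ratOp_mul (h : IsRestrict T D τ) {R R₁ : RatFunc ℝ}
    (hR : BijPoly D τ R.denom) (hR₁ : BijPoly D τ R₁.denom) (v w : V) :
    (v, w) ∈ (ratOp (R * R₁) T).graph ↔
      QuotRel D τ (R.num * R₁.num) (R.denom * R₁.denom) v w := by
  refine h.mem_graph_ratOp_of_eq_div (hR.mul hR₁) ?_ v w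
  rw [map_mul, map_mul, ← div_mul_div_comm, RatFunc.num_div_denom, RatFunc.num_div_denom]

theorem IsRestrict.mem_graph_ratOp_add (h : IsRestrict T D τ) {R R₁ : RatFunc ℝ}
    (hR : BijPoly D τ R.denom) (hR₁ : BijPoly D τ R₁.denom) (v w : V) :
    (v, w) ∈ (ratOp (R + R₁) T).graph ↔
      QuotRel D τ (R.num * R₁.denom + R₁.num * R.denom) (R.denom * R₁.denom) v w := by
  refine h.mem_graph_ratOp_of_eq_div (hR.mul hR₁) ?_ v w
  conv_lhs => rw [← RatFunc.num_div_denom R, ← RatFunc.num_div_denom R₁]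
  rw [div_add_div _ _ (RatFunc.algebraMap_ne_zero R.denom_ne_zero)
    (RatFunc.algebraMap_ne_zero R₁.denom_ne_zero), map_add, map_mul, map_mul, map_mul,
    mul_comm (algebraMap ℝ[X] (RatFunc ℝ) R.denom) (algebraMap ℝ[X] (RatFunc ℝ) R₁.num)]

theorem opComp_ratOp_le {R R₁ : RatFunc ℝ} (hR : Disjoint (poleSet R) (sSpectrum T))
    (hR₁ : Disjoint (poleSet R₁) (sSpectrum T)) :
    opComp (ratOp R T) (ratOp R₁ T) ≤ ratOp (R * R₁) T := by
  obtain ⟨D, τ, h⟩ := exists_isRestrict T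
  have hb := h.bijPoly_denom hR
  have hb₁ := h.bijPoly_denom hR₁
  refine LinearPMap.le_of_le_graph ?_
  rintro ⟨v, w⟩ hvw
  rw [mem_graph_opComp] at hvw
  simp only [h.mem_graph_ratOp hb, h.mem_graph_ratOp hb₁] at hvw
  exact (h.mem_graph_ratOp_mul hb hb₁ v w).2 (QuotRel.mul hb hb₁.ne_zero hvw)

theorem opComp_ratOp_eq {R R₁ : RatFunc ℝ} (hR : Disjoint (poleSet R) (sSpectrum T))
    (hR₁ : Disjoint (poleSet R₁) (sSpectrum T)) (hR₀ : R ≠ 0)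
    (hd : R₁ = 0 ∨ R.denom.natDegree ≤ R.num.natDegree ∨ R₁.num.natDegree ≤ R₁.denom.natDegree) :
    opComp (ratOp R T) (ratOp R₁ T) = ratOp (R * R₁) T := by
  refine le_antisymm (opComp_ratOp_le hR hR₁) (LinearPMap.le_of_le_graph ?_)
  obtain ⟨D, τ, h⟩ := exists_isRestrict T
  have hb := h.bijPoly_denom hR
  have hb₁ := h.bijPoly_denom hR₁
  rintro ⟨v, w⟩ hvw
  rw [mem_graph_opComp]
  simp only [h.mem_graph_ratOp hb, h.mem_graph_ratOp hb₁]
  rw [← RatFunc.num_eq_zero_iff] at hd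
  exact QuotRel.comp_of_mul hb hb₁.ne_zero (RatFunc.num_ne_zero hR₀) hd
    ((h.mem_graph_ratOp_mul hb hb₁ v w).1 hvw)

theorem add_ratOp_le {R R₁ : RatFunc ℝ} (hR : Disjoint (poleSet R) (sSpectrum T))
    (hR₁ : Disjoint (poleSet R₁) (sSpectrum T)) :
    ratOp R T + ratOp R₁ T ≤ ratOp (R + R₁) T := by
  obtain ⟨D, τ, h⟩ := exists_isRestrict T
  have hb := h.bijPoly_denom hR
  have hb₁ := h.bijPoly_denom hR₁
  refine LinearPMap.le_of_le_graph ?_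
  rintro ⟨v, w⟩ hvw
  rw [mem_graph_add] at hvw
  simp only [h.mem_graph_ratOp hb, h.mem_graph_ratOp hb₁] at hvw
  exact (h.mem_graph_ratOp_add hb hb₁ v w).2 (QuotRel.add hb hb₁ hvw)

theorem add_ratOp_eq {R R₁ : RatFunc ℝ} (hR : Disjoint (poleSet R) (sSpectrum T))
    (hR₁ : Disjoint (poleSet R₁) (sSpectrum T)) (hR₀ : R ≠ 0)
    (hd : (R.num * R₁.denom + R₁.num * R.denom).natDegree =
      max (R.num * R₁.denom).natDegree (R₁.num * R.denom).natDegree) :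
    ratOp R T + ratOp R₁ T = ratOp (R + R₁) T := by
  refine le_antisymm (add_ratOp_le hR hR₁) (LinearPMap.le_of_le_graph ?_)
  obtain ⟨D, τ, h⟩ := exists_isRestrict T
  have hb := h.bijPoly_denom hR
  have hb₁ := h.bijPoly_denom hR₁
  rintro ⟨v, w⟩ hvw
  rw [mem_graph_add]
  simp only [h.mem_graph_ratOp hb, h.mem_graph_ratOp hb₁]
  exact QuotRel.exists_of_add hb hb₁ (RatFunc.num_ne_zero hR₀) hd
    ((h.mem_graph_ratOp_add hb hb₁ v w).1 hvw)

theorem IsRestrict.mem_graph_sOp_ratOp (h : IsRestrict T D τ) {R : RatFunc ℝ}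
    (hR : BijPoly D τ R.denom) (t : ℍ) (v w : V) :
    (v, w) ∈ (_root_.sOp (ratOp R T) t).graph ↔
      ∃ z ∈ iterDom D τ (2 * max R.num.natDegree R.denom.natDegree),
        aeval τ (R.denom * R.denom) z = v ∧ aeval τ (sNum t R.num R.denom) z = w := by
  rw [mem_graph_sOp, ← exists_quotRel_sq_iff hR]
  simp only [h.mem_graph_ratOp hR]

/-! ### Closedness and the spectral inclusion -/

variable [CompleteSpace V]

/-- Q(T)⁻¹ is bounded as the inverse of a closed bijection, so the graph is a continuous preimage of
the closed graph of P(T). -/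
theorem isClosedOp_ratOp (hT : IsClosedOp T) (hρ : (sResolventSet T).Nonempty) {R : RatFunc ℝ}
    (hR : Disjoint (poleSet R) (sSpectrum T)) : IsClosedOp (ratOp R T) := by
  obtain ⟨D, τ, h⟩ := exists_isRestrict T
  have hb := h.bijPoly_denom hR
  obtain ⟨B, hB⟩ := (hasBoundedInverse_iff _).1 (hasBoundedInverse_of_isClosedOp
    ((h.polyOp R.denom).isClosed_iff.2 (h.isClosed_polyGraph hT hρ _))
    (fun v hv => hb.inj v ((h.polyOp _ v 0).1 hv).1 ((h.polyOp _ v 0).1 hv).2)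
    (fun w => (hb.surj w).imp fun v hv => (h.polyOp _ v w).2 hv))
  have hB' : ∀ v w, _ := fun v w => (h.polyOp R.denom v w).symm.trans (hB v w)
  have hgraph : {x : V × V | x ∈ (ratOp R T).graph} =
      (fun x : V × V => (B x.1, x.2)) ⁻¹' polyGraph D τ R.num := by
    ext ⟨v, w⟩
    simp only [Set.mem_ofPred_eq, Set.mem_preimage, polyGraph, ratOp, mem_graph_opComp,
      h.mem_graph_inverse_polyOp hb, hB', h.polyOp R.num _ w]
    simp
  unfold IsClosedOp
  rw [hgraph]
  exact (h.isClosed_polyGraph hT hρ _).preimage (by fun_prop)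

theorem ratExt_image_subset (hT : IsClosedOp T) (hρ : (sResolventSet T).Nonempty) {R : RatFunc ℝ}
    (hR : Disjoint (poleSet R) (sSpectrum T)) :
    ratExt R '' extSSpectrum T ⊆ extSSpectrum (ratOp R T) := by
  obtain ⟨D, τ, h⟩ := exists_isRestrict T
  have hb := h.bijPoly_denom hR
  rintro _ ⟨_, ⟨s, hs, rfl⟩ | ⟨rfl, hT'⟩, rfl⟩
  · have hpole : s ∉ poleSet R := Set.disjoint_right.1 hR hs
    have hval : ratExt R (s : OnePoint ℍ) =
        ((aeval s R.num * (aeval s R.denom)⁻¹ : ℍ) : OnePoint ℍ) := if_neg hpole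
    rw [hval]
    refine Or.inl ⟨_, fun ht => hs ?_, rfl⟩
    obtain ⟨B, hB⟩ := (hasBoundedInverse_iff _).1 ht
    have hB' : ∀ v w, _ := fun v w => (h.mem_graph_sOp_ratOp hb _ v w).symm.trans (hB v w)
    refine (h.mem_sResolventSet_iff hT hρ s).2
      (.sPoly_of_aeval_eq_zero (aeval_sNum_eq_zero (P := R.num) hpole) fun m hm hdvd => ?_)
    refine hb.of_dvd_sNum (fun z hz h0 => ?_) (fun w => ?_) hm hdvd
    · rw [← (hB' _ 0).1 ⟨z, hz, rfl, h0⟩, map_zero]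
    · obtain ⟨z, hz, -, h1⟩ := (hB' (B w) w).2 rfl
      exact ⟨z, hz, h1⟩
  · by_cases hd : R.denom.natDegree < R.num.natDegree
    · have hval : ratExt R OnePoint.infty = OnePoint.infty := if_pos hd
      rw [hval]
      -- If R(T) is everywhere defined, each w = Q(T)y has y ∈ D(T^deg P); as deg P > deg Q, this
      -- gives w ∈ D.
      refine Or.inr ⟨rfl, fun ⟨B, hB⟩ => hT' (h.isBoundedOp_of_forall_mem hT fun w => ?_)⟩
      obtain ⟨y, hy, rfl⟩ := hb.surj w
      have h1 : (aeval τ R.denom y, B (aeval τ R.denom y)) ∈ (ratOp R T).graph := by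
        rw [hB, mem_graph_toPMap_top]; rfl
      obtain ⟨y', hy', h2, -⟩ := (h.mem_graph_ratOp hb _ _).1 h1
      obtain rfl := hb.eq_of_aeval_eq (mem_iterDom_of_le hy' (le_max_right _ _)) hy h2
      exact mem_iterDom_one.1 (aeval_mem_iterDom hy' (by omega))
    · have hval : ratExt R OnePoint.infty =
          (((R.num.coeff R.denom.natDegree : ℝ) : ℍ) : OnePoint ℍ) := if_neg hd
      rw [hval]
      -- If the value at ∞ were in the resolvent set, each w would be in the range of the quadratic
      -- operator, which lies in D.
      refine Or.inl ⟨_, fun ht => hT' (h.isBoundedOp_of_forall_mem hT fun w => ?_), rfl⟩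
      obtain ⟨B, hB⟩ := (hasBoundedInverse_iff _).1 ht
      obtain ⟨z, hz, -, rfl⟩ := (h.mem_graph_sOp_ratOp hb _ _ _).1 ((hB _ w).2 rfl)
      exact aeval_sNum_mem R.monic_denom (not_lt.1 hd) hz

theorem ratOp_calculus {R R₁ : RatFunc ℝ} {P Q P₁ Q₁ : ℝ[X]} (hR₀ : R ≠ 0) (hQ : Q ≠ 0)
    (hQ₁ : Q₁ ≠ 0) (hR : R = algebraMap ℝ[X] (RatFunc ℝ) P / algebraMap ℝ[X] (RatFunc ℝ) Q)
    (hR₁ : R₁ = algebraMap ℝ[X] (RatFunc ℝ) P₁ / algebraMap ℝ[X] (RatFunc ℝ) Q₁)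
    (hT : IsClosedOp T) (hρ : (sResolventSet T).Nonempty)
    (hpole : Disjoint (poleSet R) (sSpectrum T)) :
    IsClosedOp (ratOp R T) ∧
      ratExt R '' extSSpectrum T ⊆ extSSpectrum (ratOp R T) ∧
      (Disjoint (poleSet R₁) (sSpectrum T) →
        opComp (ratOp R T) (ratOp R₁ T) ≤ ratOp (R * R₁) T ∧
        (0 ≤ ((P.natDegree : ℤ) - Q.natDegree) * ((P₁.natDegree : ℤ) - Q₁.natDegree) →
          opComp (ratOp R T) (ratOp R₁ T) = ratOp (R * R₁) T) ∧
        ratOp R T + ratOp R₁ T ≤ ratOp (R + R₁) T ∧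
        ((P * Q₁ + P₁ * Q).natDegree = max (P * Q₁).natDegree (P₁ * Q).natDegree →
          ratOp R T + ratOp R₁ T = ratOp (R + R₁) T)) := by
  refine ⟨isClosedOp_ratOp hT hρ hpole, ratExt_image_subset hT hρ hpole, fun hpole₁ =>
    ⟨opComp_ratOp_le hpole hpole₁, fun hd => opComp_ratOp_eq hpole hpole₁ hR₀ ?_,
      add_ratOp_le hpole hpole₁, fun hd => add_ratOp_eq hpole hpole₁ hR₀ ?_⟩⟩
  -- The degree conditions concern arbitrary fractions; the common factors F and F₁ are removed to
  -- pass to lowest terms.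
  all_goals
    obtain ⟨F, hF, rfl, rfl⟩ := RatFunc.exists_eq_num_mul_eq_denom_mul hQ hR
    obtain ⟨F₁, hF₁, rfl, rfl⟩ := RatFunc.exists_eq_num_mul_eq_denom_mul hQ₁ hR₁
    have hn : R.num ≠ 0 := RatFunc.num_ne_zero hR₀
  · by_cases hR₁₀ : R₁ = 0
    · exact Or.inl hR₁₀
    refine Or.inr ?_
    by_contra! hlt
    have hn₁ : R₁.num ≠ 0 := RatFunc.num_ne_zero hR₁₀
    rw [natDegree_mul hn hF, natDegree_mul R.denom_ne_zero hF, natDegree_mul hn₁ hF₁,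
      natDegree_mul R₁.denom_ne_zero hF₁] at hd
    push_cast at hd
    exact hd.not_gt (mul_neg_of_neg_of_pos (by omega) (by omega))
  · have h0 : (0 : ℝ[X]).natDegree = 0 := natDegree_zero
    by_cases hR₁₀ : R₁ = 0
    · rw [RatFunc.num_eq_zero_iff.2 hR₁₀, zero_mul, add_zero, h0, Nat.max_zero]
    have hn₁ : R₁.num ≠ 0 := RatFunc.num_ne_zero hR₁₀
    have hFF := mul_ne_zero hF hF₁
    rw [show R.num * F * (R₁.denom * F₁) = R.num * R₁.denom * (F * F₁) by ring,
      show R₁.num * F₁ * (R.denom * F) = R₁.num * R.denom * (F * F₁) by ring, ← add_mul,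
      natDegree_mul (mul_ne_zero hn R₁.denom_ne_zero) hFF,
      natDegree_mul (mul_ne_zero hn₁ R.denom_ne_zero) hFF] at hd
    by_cases hs : R.num * R₁.denom + R₁.num * R.denom = 0
    -- The zero polynomial has `natDegree` 0, so here the hypothesis makes both summands constant.
    · rw [hs, zero_mul, h0] at hd
      rw [hs, h0]
      omega
    · rw [natDegree_mul hs hFF] at hd
      omega

end Calculus

theorem proposition3p11 {V : Type*} [NormedAddCommGroup V] [NormedSpace ℝ V] [CompleteSpace V]
    [Module ℍ V] [Module ℍᵐᵒᵖ V] [SMulCommClass ℍ ℍᵐᵒᵖ V]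
    [IsScalarTower ℝ ℍ V] [IsScalarTower ℝ ℍᵐᵒᵖ V] [ContinuousSMul ℍ V] [ContinuousSMul ℍᵐᵒᵖ V]
    (R R₁ : RatFunc ℝ) (P Q P₁ Q₁ : ℝ[X]) (hR₀ : R ≠ 0) (hQ : Q ≠ 0) (hQ₁ : Q₁ ≠ 0)
    (hR : R = algebraMap ℝ[X] (RatFunc ℝ) P / algebraMap ℝ[X] (RatFunc ℝ) Q)
    (hR₁ : R₁ = algebraMap ℝ[X] (RatFunc ℝ) P₁ / algebraMap ℝ[X] (RatFunc ℝ) Q₁) :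
    -- right linear operators
    (∀ T : V →ₗ.[ℍᵐᵒᵖ] V, IsClosedOp T → (sResolventSet T).Nonempty →
      Disjoint (poleSet R) (sSpectrum T) →
      IsClosedOp (ratOp R T) ∧
      ratExt R '' extSSpectrum T ⊆ extSSpectrum (ratOp R T) ∧
      (Disjoint (poleSet R₁) (sSpectrum T) →
        opComp (ratOp R T) (ratOp R₁ T) ≤ ratOp (R * R₁) T ∧
        (0 ≤ ((P.natDegree : ℤ) - Q.natDegree) * ((P₁.natDegree : ℤ) - Q₁.natDegree) →
          opComp (ratOp R T) (ratOp R₁ T) = ratOp (R * R₁) T) ∧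
        ratOp R T + ratOp R₁ T ≤ ratOp (R + R₁) T ∧
        ((P * Q₁ + P₁ * Q).natDegree = max (P * Q₁).natDegree (P₁ * Q).natDegree →
          ratOp R T + ratOp R₁ T = ratOp (R + R₁) T))) ∧
    -- left linear operators
    (∀ T : V →ₗ.[ℍ] V, IsClosedOp T → (sResolventSet T).Nonempty →
      Disjoint (poleSet R) (sSpectrum T) →
      IsClosedOp (ratOp R T) ∧
      ratExt R '' extSSpectrum T ⊆ extSSpectrum (ratOp R T) ∧
      (Disjoint (poleSet R₁) (sSpectrum T) →
        opComp (ratOp R T) (ratOp R₁ T) ≤ ratOp (R * R₁) T ∧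
        (0 ≤ ((P.natDegree : ℤ) - Q.natDegree) * ((P₁.natDegree : ℤ) - Q₁.natDegree) →
          opComp (ratOp R T) (ratOp R₁ T) = ratOp (R * R₁) T) ∧
        ratOp R T + ratOp R₁ T ≤ ratOp (R + R₁) T ∧
        ((P * Q₁ + P₁ * Q).natDegree = max (P * Q₁).natDegree (P₁ * Q).natDegree →
          ratOp R T + ratOp R₁ T = ratOp (R + R₁) T))) := by
  exact ⟨fun _ hT hρ hpole => ratOp_calculus hR₀ hQ hQ₁ hR hR₁ hT hρ hpole,
    fun _ hT hρ hpole => ratOp_calculus hR₀ hQ hQ₁ hR hR₁ hT hρ hpole⟩
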